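/- Let $H(\mathbb D)$ be the space of analytic functions on the open unit disc $\mathbb D$. A \emph{weight} is a continuous strictly positive function $v$ on $\mathbb D$ with $\lim_{|z|\to1}v(z)=0$; it is \emph{normal} if $v(z)=v(|z|)$ for all $z$, $v$ is non-increasing in $|z|$, $$\inf_{k\in\mathbb N}\limsup_{n\to\infty}\frac{v(1-2^{-n-k})}{v(1-2^{-n})}<1\quad\text{and}\quad \sup_{n\in\mathbb N}\frac{v(1-2^{-n})}{v(1-2^{-n-1})}<\infty .$$ Put $\|f\|_{H_v^\infty}=\sup_{z\in\mathbb D}v(z)|f(z)|$ and $\|f\|_{\mathcal B_v^\infty}=|f(0)|+\sup_{z\in\mathbb D}v(z)|f'(z)|$, and let $H_v^\infty$, $\mathcal B_v^\infty$ be the spaces of those $f\in H(\mathbb D)$ for which the respective norm is finite. For $g\in H(\mathbb D)$ and an analytic map $\varphi:\mathbb D\to\mathbb D$ let $$T_g^\varphi f(z)=\int_0^{\varphi(z)}f(\xi)g'(\xi)\,d\xi ,\qquad f\in H(\mathbb D),\ z\in\mathbb D.$$ The essential norm $\|T\|_e$ of a bounded operator is its distance, in operator norm, to the compact operators between the same spaces.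 Let $\mathcal X\subset H(\mathbb D)$ be a Banach space containing the constant functions, let $\|\delta_z\|$ be the norm of the evaluation functional $f\mapsto f(z)$ on $\mathcal X$, and assume: (I) the closed unit ball of $\mathcal X$ is compact in the topology of uniform convergence on compact subsets of $\mathbb D$; (II) $\lim_{|z|\to1}\|\delta_z\|=\infty$; (III) for every $0<r<1$ the operator $T_r f(z)=f(rz)$ maps $\mathcal X$ to $\mathcal X$ and is compact; (IV) $\sup_{0<r<1}\|T_r\|_{\mathcal X\to\mathcal X}<\infty$; (V) there is a constant $C$ such that every bounded $u\in H(\mathbb D)$ induces a multiplication operator $M_uf=uf$ on $\mathcal X$ with $\|M_u\|_{\mathcal X\to\mathcal X}\le C\sup_{z\in\mathbb D}|u(z)|$. Below, $\limsup_{|\varphi(z)|\to1}F(z)$ means $\lim_{s\to1^-}\sup\{F(z):|\varphi(z)|>s\}$, with $\sup\emptyset=0$. (i) For every normal weight $v$ there is a constant $c>0$, depending only on $\mathcal X$ and $v$, such that for all $g\in H(\mathbb D)$ and all analytic $\varphi:\mathbb D\to\mathbb D$ for which $T_g^\varphi:\mathcal X\to H_v^\infty$ is bounded, $$c^{-1}L\le\|T_g^\varphi\|_{e,\mathcal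 X\to H_v^\infty}\le cL,\qquad L=\limsup_{|\varphi(z)|\to1}(1-|z|)\,v(z)\,|(g\circ\varphi)'(z)|\,\|\delta_{\varphi(z)}\| .$$ (ii) There is a constant $c>0$, depending only on $\mathcal X$, such that for all weights $v$, all $g\in H(\mathbb D)$ and all analytic $\varphi:\mathbb D\to\mathbb D$ for which $T_g^\varphi:\mathcal X\to\mathcal B_v^\infty$ is bounded, $$c^{-1}L\le\|T_g^\varphi\|_{e,\mathcal X\to\mathcal B_v^\infty}\le cL,\qquad L=\limsup_{|\varphi(z)|\to1}v(z)\,|(g\circ\varphi)'(z)|\,\|\delta_{\varphi(z)}\| .$$ -/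

import Mathlib

open Complex Filter Topology
open scoped ENNReal NNReal Complex.UnitDisc

noncomputable section

namespace VolterraEss

/-- Extension of a function on the unit disc to `ℂ` by zero. It only serves to speak about complex
derivatives at points of the (open) disc and about values at complex numbers of modulus `< 1`. -/
def ext (f : 𝔻 → ℂ) (z : ℂ) : ℂ :=
  if h : ‖z‖ < 1 then f (UnitDisc.mk z h) else 0

theorem ext_coe (f : 𝔻 → ℂ) (z : 𝔻) : ext f z = f z := by
  simp [ext, z.norm_lt_one]

theorem ext_add (f g : 𝔻 → ℂ) : ext (f + g) = ext f + ext g := by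
  funext z
  by_cases h : ‖z‖ < 1 <;> simp [ext, h]

theorem ext_smul (c : ℂ) (f : 𝔻 → ℂ) : ext (c • f) = c • ext f := by
  funext z
  by_cases h : ‖z‖ < 1 <;> simp [ext, h]

theorem ext_zero : ext 0 = 0 := by
  funext z
  simp [ext]

/-- `f` is analytic (holomorphic) on the unit disc. -/
def IsHol (f : 𝔻 → ℂ) : Prop := DifferentiableOn ℂ (ext f) (Metric.ball 0 1)

/-- The complex derivative `f'(z)` of a function on the disc. -/
def dd (f : 𝔻 → ℂ) (z : 𝔻) : ℂ := deriv (ext f) z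

/-- The analytic functions as a subspace of `C(𝔻, ℂ)`. -/
def holSub : Submodule ℂ C(𝔻, ℂ) where
  carrier := {f | IsHol f}
  add_mem' {f g} hf hg := by
    change IsHol (f + g)
    unfold IsHol at *
    rw [ext_add]
    exact DifferentiableOn.add hf hg
  zero_mem' := by
    change DifferentiableOn ℂ (ext 0) _
    rw [ext_zero]
    exact differentiableOn_const 0
  smul_mem' c f hf := by
    change IsHol (c • ⇑f)
    unfold IsHol at *
    rw [ext_smul]
    exact DifferentiableOn.const_smul hf c

/-- The space `H(𝔻)` of analytic functions on the unit disc, with the compact-open topology. -/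
def HolD : Type := ↥holSub

instance : AddCommGroup HolD := inferInstanceAs (AddCommGroup ↥holSub)

instance : Module ℂ HolD := inferInstanceAs (Module ℂ ↥holSub)

instance : TopologicalSpace HolD := inferInstanceAs (TopologicalSpace ↥holSub)

instance : CoeFun HolD fun _ => 𝔻 → ℂ := ⟨fun f => f.1⟩

theorem HolD.isHol (f : HolD) : IsHol f := f.2

theorem HolD.add_apply (f g : HolD) (z : 𝔻) : (f + g) z = f z + g z := rfl

theorem HolD.smul_apply (c : ℂ) (f : HolD) (z : 𝔻) : (c • f) z = c * f z := rfl

theorem HolD.differentiableAt (f : HolD) (z : 𝔻) : DifferentiableAt ℂ (ext f) z :=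
  f.isHol.differentiableAt (Metric.isOpen_ball.mem_nhds (mem_ball_zero_iff.2 z.norm_lt_one))

theorem HolD.dd_add (f g : HolD) (z : 𝔻) : dd (f + g : HolD) z = dd f z + dd g z := by
  change deriv (ext (⇑f.1 + ⇑g.1)) z = _
  rw [ext_add]
  exact deriv_add (f.differentiableAt z) (g.differentiableAt z)

theorem HolD.dd_smul (c : ℂ) (f : HolD) (z : 𝔻) : dd (c • f : HolD) z = c * dd f z := by
  change deriv (ext (c • ⇑f.1)) z = _
  rw [ext_smul]
  exact deriv_const_smul c (f.differentiableAt z)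

theorem HolD.eq_zero_of_dd (f : HolD) (h0 : f 0 = 0) (h : ∀ z, dd f z = 0) : f = 0 := by
  apply Subtype.ext
  ext z
  have h1 : Set.EqOn (deriv (ext f)) 0 (Metric.ball 0 1) := fun w hw =>
    h (UnitDisc.mk w (mem_ball_zero_iff.1 hw))
  have h2 := Metric.isOpen_ball.is_const_of_deriv_eq_zero
    (convex_ball (0 : ℂ) 1).isPreconnected f.isHol h1
    (mem_ball_zero_iff.2 z.norm_lt_one) (mem_ball_zero_iff.2 (0 : 𝔻).norm_lt_one)
  rw [ext_coe, ext_coe] at h2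
  exact h2.trans h0

/-- The filter of all `z` in the disc with `|z| → 1`. -/
def toBoundary : Filter 𝔻 := comap (fun z => ‖(z : ℂ)‖) (𝓝 1)

/-- A weight: a continuous strictly positive function on the disc tending to `0` as `|z| → 1`. -/
structure Weight where
  toFun : 𝔻 → ℝ
  continuous_toFun : Continuous toFun
  pos : ∀ z, 0 < toFun z
  tendsto_zero : Tendsto toFun toBoundary (𝓝 0)

instance : CoeFun Weight fun _ => 𝔻 → ℝ := ⟨Weight.toFun⟩

/-- The point `1 - 2⁻ⁿ` of the disc. -/
def dyadic (n : ℕ) : 𝔻 :=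
  UnitDisc.mk ((1 - (1 / 2) ^ n : ℝ) : ℂ) (by
    have h1 : (0 : ℝ) < (1 / 2) ^ n := by positivity
    have h2 : ((1 : ℝ) / 2) ^ n ≤ 1 := pow_le_one₀ (by norm_num) (by norm_num)
    rw [Complex.norm_real, Real.norm_eq_abs, abs_lt]
    constructor <;> linarith)

/-- Normal weights. The two quotients are read in `[0, ∞]`. -/
structure Weight.IsNormal (v : Weight) : Prop where
  radial : ∀ z w : 𝔻, ‖(z : ℂ)‖ = ‖(w : ℂ)‖ → v z = v w
  antitone : ∀ z w : 𝔻, ‖(z : ℂ)‖ ≤ ‖(w : ℂ)‖ → v w ≤ v z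
  inf_limsup_lt_one :
    ⨅ k : ℕ, limsup (fun n : ℕ => ENNReal.ofReal (v (dyadic (n + k)) / v (dyadic n))) atTop < 1
  sup_lt_top : ⨆ n : ℕ, ENNReal.ofReal (v (dyadic n) / v (dyadic (n + 1))) < ∞

section Bounds

variable (v : Weight) (u : HolD → 𝔻 → ℂ)

/-- For `u f z` linear in `f`: those `f` for which `v(z) |u f z|` is bounded form a subspace. -/
def bddSub (hadd : ∀ f g z, u (f + g) z = u f z + u g z)
    (hsmul : ∀ (c : ℂ) f z, u (c • f) z = c * u f z) : Submodule ℂ HolD where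
  carrier := {f | BddAbove (Set.range fun z => v z * ‖u f z‖)}
  add_mem' {f g} := by
    rintro ⟨A, hA⟩ ⟨B, hB⟩
    refine ⟨A + B, ?_⟩
    rintro _ ⟨z, rfl⟩
    have h1 : v z * ‖u f z‖ ≤ A := hA ⟨z, rfl⟩
    have h2 : v z * ‖u g z‖ ≤ B := hB ⟨z, rfl⟩
    have h3 := mul_le_mul_of_nonneg_left (norm_add_le (u f z) (u g z)) (v.pos z).le
    simp only [hadd]
    linarith
  zero_mem' := by
    refine ⟨0, ?_⟩
    rintro _ ⟨z, rfl⟩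
    have h := hsmul 0 0 z
    rw [zero_smul, zero_mul] at h
    simp [h]
  smul_mem' c f := by
    rintro ⟨A, hA⟩
    refine ⟨‖c‖ * A, ?_⟩
    rintro _ ⟨z, rfl⟩
    have h1 : v z * ‖u f z‖ ≤ A := hA ⟨z, rfl⟩
    have h2 := mul_le_mul_of_nonneg_left h1 (norm_nonneg c)
    simp only [hsmul, norm_mul]
    linarith

variable {v u}

theorem iSup_smul (hsmul : ∀ (c : ℂ) f z, u (c • f) z = c * u f z) (c : ℂ) (f : HolD) :
    ⨆ z, v z * ‖u (c • f) z‖ = ‖c‖ * ⨆ z, v z * ‖u f z‖ := by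
  rw [Real.mul_iSup_of_nonneg (norm_nonneg c)]
  congr 1
  funext z
  rw [hsmul, norm_mul]
  ring

theorem iSup_add_le (hadd : ∀ f g z, u (f + g) z = u f z + u g z) {f g : HolD}
    (hf : BddAbove (Set.range fun z => v z * ‖u f z‖))
    (hg : BddAbove (Set.range fun z => v z * ‖u g z‖)) :
    ⨆ z, v z * ‖u (f + g) z‖ ≤ (⨆ z, v z * ‖u f z‖) + ⨆ z, v z * ‖u g z‖ := by
  have : Nonempty 𝔻 := ⟨0⟩
  refine ciSup_le fun z => ?_
  have h1 : v z * ‖u f z‖ ≤ _ := le_ciSup hf z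
  have h2 : v z * ‖u g z‖ ≤ _ := le_ciSup hg z
  have h3 := mul_le_mul_of_nonneg_left (norm_add_le (u f z) (u g z)) (v.pos z).le
  rw [hadd]
  linarith

theorem iSup_nonneg' (f : HolD) : 0 ≤ ⨆ z, v z * ‖u f z‖ :=
  Real.iSup_nonneg fun z => mul_nonneg (v.pos z).le (norm_nonneg _)

theorem eq_zero_of_iSup {f : HolD} (hf : BddAbove (Set.range fun z => v z * ‖u f z‖))
    (h : ⨆ z, v z * ‖u f z‖ ≤ 0) (z : 𝔻) : u f z = 0 := by
  have h1 : v z * ‖u f z‖ ≤ 0 := (le_ciSup hf z).trans h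
  have h2 : ‖u f z‖ ≤ 0 := by
    by_contra hc
    exact absurd h1 (not_le.2 (mul_pos (v.pos z) (not_le.1 hc)))
  exact norm_le_zero_iff.1 h2

end Bounds

/-! ### The space `H_v^∞` -/

/-- The subspace of all `f ∈ H(𝔻)` with `sup_z v(z) |f(z)| < ∞`. -/
def hInfSub (v : Weight) : Submodule ℂ HolD :=
  bddSub v (fun f z => f z) HolD.add_apply HolD.smul_apply

/-- The weighted space `H_v^∞` (a separate type, as its topology is the norm topology and not the
compact-open one). -/
def HInf (v : Weight) : Type := ↥(hInfSub v)

namespace HInf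

variable {v : Weight}

instance : AddCommGroup (HInf v) := inferInstanceAs (AddCommGroup ↥(hInfSub v))

instance : Module ℂ (HInf v) := inferInstanceAs (Module ℂ ↥(hInfSub v))

/-- An element of `H_v^∞` as an analytic function on the disc. -/
def toHolD (f : HInf v) : HolD := Subtype.val f

instance : Norm (HInf v) := ⟨fun f => ⨆ z, v z * ‖f.toHolD z‖⟩

theorem norm_def (f : HInf v) : ‖f‖ = ⨆ z, v z * ‖f.toHolD z‖ := rfl

theorem bdd (f : HInf v) : BddAbove (Set.range fun z => v z * ‖f.toHolD z‖) := f.2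

theorem core (v : Weight) : NormedSpace.Core ℂ (HInf v) where
  norm_nonneg f := iSup_nonneg' (u := fun f z => f z) f.toHolD
  norm_smul c f := iSup_smul (u := fun f z => f z) HolD.smul_apply c f.toHolD
  norm_triangle f g := iSup_add_le (u := fun f z => f z) HolD.add_apply f.bdd g.bdd
  norm_eq_zero_iff f := by
    constructor
    · intro h
      have h1 := eq_zero_of_iSup (u := fun f z => f z) f.bdd h.le
      apply Subtype.ext
      apply Subtype.ext
      ext z
      exact h1 z
    · rintro rfl
      have h := iSup_smul (v := v) (u := fun f z => f z) HolD.smul_apply 0 0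
      rw [zero_smul, norm_zero, zero_mul] at h
      exact h

instance : NormedAddCommGroup (HInf v) := NormedAddCommGroup.ofCore (core v)

instance : NormedSpace ℂ (HInf v) := NormedSpace.ofCore (core v)

end HInf

/-! ### The Bloch-type space `B_v^∞` -/

/-- The subspace of all `f ∈ H(𝔻)` with `sup_z v(z) |f'(z)| < ∞`. -/
def blochSub (v : Weight) : Submodule ℂ HolD :=
  bddSub v (fun f z => dd f z) HolD.dd_add HolD.dd_smul

/-- The Bloch-type space `B_v^∞`. -/
def Bloch (v : Weight) : Type := ↥(blochSub v)

namespace Bloch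

variable {v : Weight}

instance : AddCommGroup (Bloch v) := inferInstanceAs (AddCommGroup ↥(blochSub v))

instance : Module ℂ (Bloch v) := inferInstanceAs (Module ℂ ↥(blochSub v))

/-- An element of `B_v^∞` as an analytic function on the disc. -/
def toHolD (f : Bloch v) : HolD := Subtype.val f

instance : Norm (Bloch v) := ⟨fun f => ‖f.toHolD 0‖ + ⨆ z, v z * ‖dd f.toHolD z‖⟩

theorem norm_def (f : Bloch v) : ‖f‖ = ‖f.toHolD 0‖ + ⨆ z, v z * ‖dd f.toHolD z‖ := rfl

theorem bdd (f : Bloch v) : BddAbove (Set.range fun z => v z * ‖dd f.toHolD z‖) := f.2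

theorem core (v : Weight) : NormedSpace.Core ℂ (Bloch v) where
  norm_nonneg f :=
    add_nonneg (norm_nonneg _) (iSup_nonneg' (u := fun f z => dd f z) f.toHolD)
  norm_smul c f := by
    have h1 := iSup_smul (v := v) (u := fun f z => dd f z) HolD.dd_smul c f.toHolD
    have h2 : ‖(c • f.toHolD) 0‖ = ‖c‖ * ‖f.toHolD 0‖ := by
      rw [HolD.smul_apply, norm_mul]
    rw [norm_def, norm_def, mul_add, ← h1, ← h2]
    rfl
  norm_triangle f g := by
    have h1 := iSup_add_le (u := fun f z => dd f z) HolD.dd_add f.bdd g.bdd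
    have h2 : ‖(f.toHolD + g.toHolD) 0‖ ≤ ‖f.toHolD 0‖ + ‖g.toHolD 0‖ := norm_add_le _ _
    rw [norm_def, norm_def, norm_def]
    refine (add_le_add h2 h1).trans (le_of_eq ?_)
    ring
  norm_eq_zero_iff f := by
    constructor
    · intro h
      have h0 := norm_nonneg (f.toHolD 0)
      have h1 := iSup_nonneg' (v := v) (u := fun f z => dd f z) f.toHolD
      rw [norm_def] at h
      apply Subtype.ext
      exact HolD.eq_zero_of_dd f.toHolD (norm_le_zero_iff.1 (by linarith))
        (eq_zero_of_iSup (u := fun f z => dd f z) f.bdd (by linarith))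
    · rintro rfl
      have h := iSup_smul (v := v) (u := fun f z => dd f z) HolD.dd_smul 0 0
      rw [zero_smul, norm_zero, zero_mul] at h
      have h2 : ‖((0 : Bloch v).toHolD) 0‖ = 0 := norm_zero
      rw [norm_def, h2, zero_add]
      exact h

instance : NormedAddCommGroup (Bloch v) := NormedAddCommGroup.ofCore (core v)

instance : NormedSpace ℂ (Bloch v) := NormedSpace.ofCore (core v)

end Bloch

/-! ### Banach spaces of analytic functions

A Banach space `X ⊆ H(𝔻)` is given by a Banach space `X` and the (injective, linear) inclusion
`ι : X → H(𝔻)`. -/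

section Conditions

variable {X : Type*} [NormedAddCommGroup X] [NormedSpace ℂ X] (ι : X →ₗ[ℂ] HolD)

/-- The norm `‖δ_z‖ = sup {|f(z)| : ‖f‖ ≤ 1}` of the evaluation functional, in `[0, ∞]`. -/
def evalNorm (z : 𝔻) : ℝ≥0∞ := ⨆ (f : X) (_ : ‖f‖ ≤ 1), ‖ι f z‖ₑ

/-- `X` contains the constant functions. -/
def ContainsConstants : Prop := ∀ c : ℂ, ∃ f : X, ∀ z, ι f z = c

/-- (I): the closed unit ball is compact in the compact-open topology. -/
def CondI : Prop := IsCompact (ι '' Metric.closedBall (0 : X) 1)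

/-- (II): `‖δ_z‖ → ∞` as `|z| → 1`. -/
def CondII : Prop := Tendsto (evalNorm ι) toBoundary (𝓝 ∞)

/-- `S` is the operator `T_r : X → X`, `f ↦ f_r`, `f_r(z) = f(rz)`. -/
def IsDilation (r : ℝ) (S : X →L[ℂ] X) : Prop :=
  ∀ f z, ι (S f) z = ext (ι f) (r * z)

/-- (III): for `0 < r < 1` the operator `T_r : X → X` is (well defined and) compact. -/
def CondIII : Prop :=
  ∀ r : ℝ, 0 < r → r < 1 → ∃ S : X →L[ℂ] X, IsDilation ι r S ∧ IsCompactOperator S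

/-- (IV): `sup_{0 < r < 1} ‖T_r‖ < ∞`. -/
def CondIV : Prop :=
  ∃ C : ℝ, ∀ r : ℝ, 0 < r → r < 1 → ∃ S : X →L[ℂ] X, IsDilation ι r S ∧ ‖S‖ ≤ C

/-- (V): for `u ∈ H^∞`, multiplication by `u` is a bounded operator on `X`, of norm at most a
constant times `‖u‖_∞`. -/
def CondV : Prop :=
  ∃ C : ℝ, ∀ u : HolD, BddAbove (Set.range fun z => ‖u z‖) →
    ∃ M : X →L[ℂ] X, (∀ f z, ι (M f) z = u z * ι f z) ∧ ‖M‖ ≤ C * ⨆ z, ‖u z‖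

end Conditions

/-- The essential norm of a bounded operator: its distance to the compact operators. -/
def essNorm {X Y : Type*} [NormedAddCommGroup X] [NormedSpace ℂ X] [NormedAddCommGroup Y]
    [NormedSpace ℂ Y] (T : X →L[ℂ] Y) : ℝ≥0∞ :=
  ⨅ (K : X →L[ℂ] Y) (_ : IsCompactOperator K), ‖T - K‖ₑ

/-- The generalized Volterra operator `T_g^φ f (z) = ∫_0^{φ(z)} f(ξ) g'(ξ) dξ`, the integral taken
along the segment `ξ = t φ(z)`, `0 ≤ t ≤ 1`. -/
def volterra (g : HolD) (φ : 𝔻 → 𝔻) (f : HolD) (z : 𝔻) : ℂ :=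
  ∫ t in (0 : ℝ)..1, ext f (t * φ z) * deriv (ext g) (t * φ z) * φ z

/-- `limsup_{|φ(z)| → 1} F(z) = lim_{s → 1} sup_{|φ(z)| > s} F(z)`, which is `0` if `|φ|` is bounded
away from `1`. -/
def limsupAt (φ : 𝔻 → 𝔻) (F : 𝔻 → ℝ≥0∞) : ℝ≥0∞ :=
  limsup F (comap φ toBoundary)

end VolterraEss

end

/-!
Since `(T_g^φ f)' = (f ∘ φ) (g ∘ φ)'`, the operator `T_g^φ : X → B_v^∞` behaves like a weighted
composition operator, and `v(z) |(g ∘ φ)'(z)| ‖δ_{φ(z)}‖` is the norm of `f ↦ v(z) (T_g^φ f)'(z)`.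

*Upper bound.* `T_g^φ T_r` is compact. As `r → 1`, the functions `f - T_r f`, `‖f‖ ≤ 1`, tend to `0`
uniformly where `|φ| ≤ s`, by compactness of the unit ball of `X`, so that only the points with
`|φ(z)| > s` contribute to `‖T_g^φ - T_g^φ T_r‖`.

*Lower bound.* As `T_r f → f` pointwise, `‖δ_w‖` is controlled by the bounded functions `T_r f`,
`‖f‖ ≤ 1`. A compact `K` maps these into a set with a finite `ε`-net, so up to subtracting one of
finitely many bounded functions they are almost annihilated by `K`; since `‖δ_w‖ → ∞`, bounded
functions do not contribute to the limit superior.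

If `v` is normal, then `H_v^∞ = B_w^∞` with `w(z) = (1 - |z|) v(z)`: one inclusion is Cauchy's
estimate, the other one follows by integrating `f'` across dyadic annuli, since the sums
`∑_{j ≤ n} 1 / v(1 - 2⁻ʲ)` are comparable to their last terms.
-/

noncomputable section

namespace VolterraEss

/-! ### Analytic functions and the Volterra operator -/

theorem ext_of_norm_lt (f : 𝔻 → ℂ) {z : ℂ} (h : ‖z‖ < 1) : ext f z = f (UnitDisc.mk z h) :=
  dif_pos h

theorem norm_ofReal_mul_le {t : ℝ} (ht : t ∈ Set.Icc (0 : ℝ) 1) (w : ℂ) :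
    ‖(t : ℂ) * w‖ ≤ ‖w‖ := by
  rw [norm_mul, Complex.norm_of_nonneg ht.1]
  exact mul_le_of_le_one_left (norm_nonneg _) ht.2

theorem isCompact_norm_le {s : ℝ} (hs : s < 1) : IsCompact {z : 𝔻 | ‖(z : ℂ)‖ ≤ s} := by
  have h := UnitDisc.isEmbedding_coe.isInducing.isCompact_preimage_iff
    (K := Metric.closedBall (0 : ℂ) s) fun z hz =>
      ⟨UnitDisc.mk z ((mem_closedBall_zero_iff.1 hz).trans_lt hs), rfl⟩
  simpa [Set.preimage] using h.2 (isCompact_closedBall _ _)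

theorem exists_lt_one_of_eventually_toBoundary {p : 𝔻 → Prop} (h : ∀ᶠ z in toBoundary, p z) :
    ∃ s < 1, ∀ z : 𝔻, s < ‖(z : ℂ)‖ → p z := by
  rw [toBoundary, eventually_comap, Metric.eventually_nhds_iff] at h
  obtain ⟨ε, hε, h⟩ := h
  refine ⟨1 - ε, by linarith, fun z hz => h ?_ z rfl⟩
  rw [Real.dist_eq, abs_lt]
  constructor <;> linarith [z.norm_lt_one]

theorem HolD.sub_apply (f g : HolD) (z : 𝔻) : (f - g) z = f z - g z := rfl

theorem HolD.continuous_eval : Continuous fun p : HolD × 𝔻 => p.1 p.2 := by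
  have : LocallyCompactSpace 𝔻 :=
    (Metric.isOpen_ball : IsOpen (Metric.ball (0 : ℂ) 1)).locallyCompactSpace
  have h : Continuous fun p : HolD × 𝔻 => (p.1.1, p.2) :=
    (continuous_subtype_val.comp continuous_fst).prodMk continuous_snd
  exact (ContinuousEval.continuous_eval (F := C(𝔻, ℂ))).comp h

theorem HolD.continuousAt_ext (F : HolD) (w : 𝔻) :
    ContinuousAt (fun p : HolD × ℂ => ext p.1 p.2) (F, (w : ℂ)) := by
  have hopen : IsOpenEmbedding (Prod.map id (↑) : HolD × 𝔻 → HolD × ℂ) :=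
    IsOpenEmbedding.id.prodMap Metric.isOpen_ball.isOpenEmbedding_subtypeVal
  refine (hopen.continuousAt_iff (x := (F, w))).1 ?_
  simpa [Function.comp_def, ext_coe] using HolD.continuous_eval.continuousAt

theorem HolD.norm_dd_le (f : HolD) {z : 𝔻} {ρ M : ℝ} (hρ : 0 < ρ) (hz : ‖(z : ℂ)‖ + ρ < 1)
    (h : ∀ w : 𝔻, ‖(w : ℂ)‖ ≤ ‖(z : ℂ)‖ + ρ → ‖f w‖ ≤ M) : ‖dd f z‖ ≤ M / ρ := by
  have hball : ∀ w ∈ Metric.closedBall (z : ℂ) ρ, ‖w‖ ≤ ‖(z : ℂ)‖ + ρ := fun w hw =>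
    norm_le_of_mem_closedBall hw
  refine norm_deriv_le_of_forall_mem_sphere_norm_le hρ ?_ fun w hw => ?_
  · refine DifferentiableOn.diffContOnCl ?_
    rw [closure_ball _ hρ.ne']
    exact f.isHol.mono fun w hw => mem_ball_zero_iff.2 ((hball w hw).trans_lt hz)
  · have hw' := hball w (Metric.sphere_subset_closedBall hw)
    rw [ext_of_norm_lt _ (hw'.trans_lt hz)]
    exact h _ hw'

theorem HolD.norm_sub_le (f : HolD) {s M : ℝ} (hs : s < 1)
    (h : ∀ w : 𝔻, ‖(w : ℂ)‖ ≤ s → ‖dd f w‖ ≤ M) {z w : 𝔻} (hz : ‖(z : ℂ)‖ ≤ s)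
    (hw : ‖(w : ℂ)‖ ≤ s) : ‖f z - f w‖ ≤ M * ‖(z : ℂ) - w‖ := by
  have hlt : ∀ {x : ℂ}, x ∈ Metric.closedBall (0 : ℂ) s → ‖x‖ < 1 := fun hx =>
    (mem_closedBall_zero_iff.1 hx).trans_lt hs
  have h' := (convex_closedBall (0 : ℂ) s).norm_image_sub_le_of_norm_deriv_le (f := ext f)
    (C := M) (fun x hx => f.differentiableAt (UnitDisc.mk x (hlt hx)))
    (fun x hx => h (UnitDisc.mk x (hlt hx)) (mem_closedBall_zero_iff.1 hx))
    (mem_closedBall_zero_iff.2 hw) (mem_closedBall_zero_iff.2 hz)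
  rwa [ext_coe, ext_coe] at h'

theorem IsHol.differentiableAt {f : 𝔻 → ℂ} (hf : IsHol f) (z : 𝔻) :
    DifferentiableAt ℂ (ext f) z :=
  DifferentiableOn.differentiableAt hf
    (Metric.isOpen_ball.mem_nhds (mem_ball_zero_iff.2 z.norm_lt_one))

theorem dd_comp {G : ℂ → ℂ} {φ : 𝔻 → 𝔻} (hφ : IsHol fun z => (φ z : ℂ)) {z : 𝔻} {G' : ℂ}
    (hG : HasDerivAt G G' (φ z)) :
    dd (fun w => G (φ w)) z = G' * dd (fun w => (φ w : ℂ)) z := by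
  rw [← ext_coe (fun w => (φ w : ℂ)) z] at hG
  refine ((hG.comp (z : ℂ) (hφ.differentiableAt z).hasDerivAt).congr_of_eventuallyEq ?_).deriv
  filter_upwards [Metric.isOpen_ball.mem_nhds (mem_ball_zero_iff.2 z.norm_lt_one)] with w hw
  simp [ext_of_norm_lt _ (mem_ball_zero_iff.1 hw)]

theorem dd_comp_holD (g : HolD) {φ : 𝔻 → 𝔻} (hφ : IsHol fun z => (φ z : ℂ)) (z : 𝔻) :
    dd (fun w => g (φ w)) z = dd g (φ z) * dd (fun w => (φ w : ℂ)) z := by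
  simpa only [ext_coe, dd] using dd_comp hφ (g.differentiableAt (φ z)).hasDerivAt

theorem HolD.continuousOn_ext_mul (f : HolD) (w : 𝔻) :
    ContinuousOn (fun t : ℝ => ext f (t * w)) (Set.Icc 0 1) :=
  f.isHol.continuousOn.comp (by fun_prop) fun _ ht =>
    mem_ball_zero_iff.2 ((norm_ofReal_mul_le ht w).trans_lt w.norm_lt_one)

theorem HolD.continuousOn_deriv_ext_mul (g : HolD) (w : 𝔻) :
    ContinuousOn (fun t : ℝ => deriv (ext g) (t * w)) (Set.Icc 0 1) :=
  (g.isHol.deriv Metric.isOpen_ball).continuousOn.comp (by fun_prop) fun _ ht =>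
    mem_ball_zero_iff.2 ((norm_ofReal_mul_le ht w).trans_lt w.norm_lt_one)

theorem exists_volterra_eq (g f : HolD) : ∃ P : ℂ → ℂ,
    (∀ w : 𝔻, HasDerivAt P (f w * dd g w) w) ∧
      ∀ (φ : 𝔻 → 𝔻) (z : 𝔻), volterra g φ f z = P (φ z) - P 0 := by
  obtain ⟨P, hP⟩ := (f.isHol.mul (g.isHol.deriv Metric.isOpen_ball)).isExactOn_ball
  refine ⟨P, fun w => ?_, fun φ z => ?_⟩
  · simpa only [Pi.mul_apply, ext_coe, dd] using hP w (mem_ball_zero_iff.2 w.norm_lt_one)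
  · have hderiv : ∀ t ∈ Set.uIcc (0 : ℝ) 1, HasDerivAt (fun t : ℝ => P (t * φ z))
        (ext f (t * φ z) * deriv (ext g) (t * φ z) * φ z) t := fun t ht => by
      rw [Set.uIcc_of_le zero_le_one] at ht
      have hline : HasDerivAt (fun t : ℝ => (t : ℂ) * φ z) (φ z) t := by
        simpa using (Complex.ofRealCLM.hasDerivAt (x := t)).mul_const (φ z : ℂ)
      exact (hP _ (mem_ball_zero_iff.2
        ((norm_ofReal_mul_le ht _).trans_lt (φ z).norm_lt_one))).comp t hline
    have hint : IntervalIntegrable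
        (fun t : ℝ => ext f (t * φ z) * deriv (ext g) (t * φ z) * φ z) MeasureTheory.volume 0 1 :=
      (((f.continuousOn_ext_mul _).mul (g.continuousOn_deriv_ext_mul _)).mul
        continuousOn_const).intervalIntegrable_of_Icc zero_le_one
    simpa [volterra] using intervalIntegral.integral_eq_sub_of_hasDerivAt hderiv hint

theorem dd_volterra {g f F : HolD} {φ : 𝔻 → 𝔻} (hφ : IsHol fun z => (φ z : ℂ))
    (hF : ∀ z, F z = volterra g φ f z) (z : 𝔻) :
    dd F z = f (φ z) * dd (fun w => g (φ w)) z := by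
  obtain ⟨P, hP, hv⟩ := exists_volterra_eq g f
  have hFP : (F : 𝔻 → ℂ) = fun w => P (φ w) - P 0 := funext fun w => (hF w).trans (hv φ w)
  rw [hFP, dd_comp (G := fun w => P w - P 0) hφ ((hP (φ z)).sub_const (P 0)),
    dd_comp_holD g hφ, mul_assoc]

theorem exists_norm_volterra_le (g : HolD) (φ : 𝔻 → 𝔻) (z : 𝔻) : ∃ B : ℝ,
    ∀ (f : HolD) (m : ℝ), (∀ w : 𝔻, ‖(w : ℂ)‖ ≤ ‖(φ z : ℂ)‖ → ‖f w‖ ≤ m) →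
      ‖volterra g φ f z‖ ≤ B * m := by
  obtain ⟨B, hB⟩ := isCompact_Icc.exists_bound_of_continuousOn
    ((g.continuousOn_deriv_ext_mul (φ z)).mul_const (φ z : ℂ))
  have hB0 : 0 ≤ B := (norm_nonneg _).trans (hB 0 ⟨le_rfl, zero_le_one⟩)
  refine ⟨B, fun f m hm => ?_⟩
  have hbound : ∀ t ∈ Set.uIoc (0 : ℝ) 1,
      ‖ext f (t * φ z) * deriv (ext g) (t * φ z) * φ z‖ ≤ B * m := fun t ht => by
    rw [Set.uIoc_of_le zero_le_one] at ht
    have ht' : t ∈ Set.Icc (0 : ℝ) 1 := ⟨ht.1.le, ht.2⟩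
    have hnorm := norm_ofReal_mul_le ht' (φ z)
    have hf : ‖ext f (t * φ z)‖ ≤ m := by
      rw [ext_of_norm_lt _ (hnorm.trans_lt (φ z).norm_lt_one)]
      exact hm _ hnorm
    rw [mul_assoc, norm_mul, mul_comm]
    exact mul_le_mul (hB t ht') hf (norm_nonneg _) hB0
  simpa [volterra] using intervalIntegral.norm_integral_le_of_norm_le_const hbound

/-! ### Evaluation functionals and dilations -/

section Conditions

variable {X : Type*} [NormedAddCommGroup X] [NormedSpace ℂ X] {ι : X →ₗ[ℂ] HolD}

theorem map_sub_apply (f g : X) (z : 𝔻) : ι (f - g) z = ι f z - ι g z := by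
  rw [map_sub, HolD.sub_apply]

theorem CondI.exists_norm_apply_le (hI : CondI ι) (z : 𝔻) :
    ∃ M : ℝ, ∀ f ∈ Metric.closedBall (0 : X) 1, ‖ι f z‖ ≤ M := by
  have hcont : Continuous fun F : HolD => F z :=
    HolD.continuous_eval.comp (Continuous.prodMk_left z)
  obtain ⟨M, hM⟩ := hI.exists_bound_of_continuousOn hcont.continuousOn
  exact ⟨M, fun f hf => hM _ ⟨f, hf, rfl⟩⟩

/-- The evaluation functional `δ_z` as a continuous linear functional on `X`. -/
def CondI.delta (hI : CondI ι) (z : 𝔻) : X →L[ℂ] ℂ :=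
  let eval : X →ₗ[ℂ] ℂ :=
    { toFun := fun f => ι f z
      map_add' := fun f g => by rw [map_add, HolD.add_apply]
      map_smul' := fun c f => by rw [map_smul, HolD.smul_apply, RingHom.id_apply, smul_eq_mul] }
  eval.mkContinuousOfExistsBound
    ((hI.exists_norm_apply_le z).imp fun _ hM => by
      simpa using eval.bound_of_ball_bound' one_pos _ hM)

theorem CondI.delta_apply (hI : CondI ι) (z : 𝔻) (f : X) : hI.delta z f = ι f z := rfl

theorem CondI.enorm_delta (hI : CondI ι) (z : 𝔻) : ‖hI.delta z‖ₑ = evalNorm ι z := by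
  refine le_antisymm ?_ (iSup₂_le fun f hf => ?_)
  · refine le_of_forall_ge fun b hb => ?_
    rcases eq_or_ne b ∞ with rfl | hb'
    · exact le_top
    lift b to ℝ≥0 using hb'
    have hunit : ∀ f : X, ‖f‖ = 1 → ‖hI.delta z f‖ ≤ b := fun f hf => by
      have h := (le_iSup₂ (f := fun (f : X) (_ : ‖f‖ ≤ 1) => ‖ι f z‖ₑ) f hf.le).trans hb
      exact_mod_cast h
    exact_mod_cast ContinuousLinearMap.opNorm_le_of_unit_norm b.coe_nonneg hunit
  · have h := (hI.delta z).le_of_opNorm_le_of_le le_rfl hf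
    rw [mul_one] at h
    exact enorm_le_iff_norm_le.2 h

/-- The dilations `T_r`, `0 < r < 1`, are compact operators on `X` of norm at most `C`. -/
def HasCompactDilations (ι : X →ₗ[ℂ] HolD) (C : ℝ≥0) : Prop :=
  ∀ r : ℝ, 0 < r → r < 1 → ∃ S : X →L[ℂ] X, IsDilation ι r S ∧ IsCompactOperator S ∧ ‖S‖ ≤ C

theorem IsDilation.unique (hι : Function.Injective ι) {r : ℝ} {S S' : X →L[ℂ] X}
    (hS : IsDilation ι r S) (hS' : IsDilation ι r S') : S = S' :=
  ContinuousLinearMap.ext fun f => hι <| Subtype.ext <| ContinuousMap.ext fun z =>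
    (hS f z).trans (hS' f z).symm

theorem exists_hasCompactDilations (hι : Function.Injective ι) (hIII : CondIII ι)
    (hIV : CondIV ι) : ∃ C : ℝ≥0, HasCompactDilations ι C := by
  obtain ⟨C, hC⟩ := hIV
  refine ⟨C.toNNReal, fun r h0 h1 => ?_⟩
  obtain ⟨S, hS, hSC⟩ := hC r h0 h1
  obtain ⟨S', hS', hcomp⟩ := hIII r h0 h1
  obtain rfl := hS.unique hι hS'
  exact ⟨S, hS, hcomp, hSC.trans (Real.le_coe_toNNReal C)⟩

theorem CondI.eventually_norm_sub_ext_mul_le (hI : CondI ι) {s : ℝ} (hs : s < 1) {η : ℝ}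
    (hη : 0 < η) : ∀ᶠ r : ℝ in 𝓝 1, ∀ f : X, ‖f‖ ≤ 1 → ∀ w : 𝔻, ‖(w : ℂ)‖ ≤ s →
      ‖ι f w - ext (ι f) (r * w)‖ ≤ η := by
  have hlocal : ∀ p ∈ (ι '' Metric.closedBall 0 1) ×ˢ {w : 𝔻 | ‖(w : ℂ)‖ ≤ s},
      ∀ᶠ q : ℝ × (HolD × 𝔻) in 𝓝 (1, p), ‖q.2.1 q.2.2 - ext q.2.1 (q.1 * q.2.2)‖ ≤ η := by
    rintro ⟨F, w⟩ -
    have heval : Continuous fun q : ℝ × (HolD × 𝔻) => q.2.1 q.2.2 :=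
      HolD.continuous_eval.comp continuous_snd
    have hdil : ContinuousAt (fun q : ℝ × (HolD × 𝔻) => ext q.2.1 (q.1 * q.2.2)) (1, F, w) := by
      have hpair : Continuous fun q : ℝ × (HolD × 𝔻) => (q.2.1, (q.1 : ℂ) * q.2.2) := by
        fun_prop
      refine ContinuousAt.comp (g := fun p : HolD × ℂ => ext p.1 p.2) ?_ hpair.continuousAt
      simpa using F.continuousAt_ext w
    refine (heval.continuousAt.sub hdil).norm.eventually_le_const ?_
    simpa [ext_coe] using hη
  filter_upwards [(hI.prod (isCompact_norm_le hs)).eventually_forall_of_forall_eventually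
    (P := fun (r : ℝ) (p : HolD × 𝔻) => ‖p.1 p.2 - ext p.1 (r * p.2)‖ ≤ η) hlocal]
    with r hr f hf w hw
  exact hr (ι f, w) ⟨⟨f, mem_closedBall_zero_iff.2 hf, rfl⟩, hw⟩

/-- The elements of `X` of norm at most `C` which are bounded functions on the disc. Taking
`C = sup ‖T_r‖`, they are the test functions for lower bounds of the essential norm. -/
def boundedBall (ι : X →ₗ[ℂ] HolD) (C : ℝ≥0) : Set X :=
  {h | ‖h‖ ≤ C ∧ ∃ M : ℝ, ∀ z, ‖ι h z‖ ≤ M}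

theorem IsDilation.exists_norm_apply_le {r : ℝ} (h0 : 0 < r) (h1 : r < 1) {S : X →L[ℂ] X}
    (hS : IsDilation ι r S) (f : X) : ∃ M : ℝ, ∀ z, ‖ι (S f) z‖ ≤ M := by
  obtain ⟨M, hM⟩ := (isCompact_norm_le h1).exists_bound_of_continuousOn
    (ι f).1.continuous.continuousOn
  refine ⟨M, fun z => ?_⟩
  have hrz : ‖(r : ℂ) * z‖ ≤ r := by
    rw [norm_mul, Complex.norm_of_nonneg h0.le]
    exact mul_le_of_le_one_right h0.le z.norm_lt_one.le
  rw [hS, ext_of_norm_lt _ (hrz.trans_lt h1)]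
  exact hM _ hrz

theorem HasCompactDilations.mul_norm_delta_le (hI : CondI ι) {C : ℝ≥0}
    (hC : HasCompactDilations ι C) {w : 𝔻} {p b : ℝ} (hp : 0 ≤ p) (hb : 0 ≤ b)
    (h : ∀ f ∈ boundedBall ι C, p * ‖ι f w‖ ≤ b) : p * ‖hI.delta w‖ ≤ b := by
  suffices ‖(p : ℂ) • hI.delta w‖ ≤ b by
    rwa [norm_smul, Complex.norm_of_nonneg hp] at this
  refine ContinuousLinearMap.opNorm_le_of_unit_norm hb fun f hf => ?_
  have hlim : Tendsto (fun r : ℝ => p * ‖ext (ι f) (r * w)‖) (𝓝[<] 1) (𝓝 (p * ‖ι f w‖)) := by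
    have hcont : ContinuousAt (fun r : ℝ => p * ‖ext (ι f) (r * w)‖) 1 := by
      refine continuousAt_const.mul (ContinuousAt.norm ?_)
      refine ContinuousAt.comp (g := ext (ι f)) (f := fun r : ℝ => (r : ℂ) * w) ?_ (by fun_prop)
      simpa using ((ι f).differentiableAt w).continuousAt
    simpa [ext_coe] using hcont.tendsto.mono_left nhdsWithin_le_nhds
  have hdil : ∀ᶠ r : ℝ in 𝓝[<] 1, p * ‖ext (ι f) (r * w)‖ ≤ b := by
    filter_upwards [Ioo_mem_nhdsLT one_pos] with r ⟨hr0, hr1⟩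
    obtain ⟨S, hS, -, hSC⟩ := hC r hr0 hr1
    rw [← hS]
    exact h _ ⟨by simpa using S.le_of_opNorm_le_of_le hSC hf.le,
      hS.exists_norm_apply_le hr0 hr1 f⟩
  rw [smul_apply, norm_smul, Complex.norm_of_nonneg hp, hI.delta_apply]
  exact le_of_tendsto hlim hdil

theorem CondII.eventually_norm_apply_le (hII : CondII ι) (hI : CondI ι) {h : X}
    (hh : ∃ M : ℝ, ∀ z, ‖ι h z‖ ≤ M) {η : ℝ} (hη : 0 < η) :
    ∀ᶠ z in toBoundary, ‖ι h z‖ ≤ η * ‖hI.delta z‖ := by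
  obtain ⟨M, hM⟩ := hh
  filter_upwards [hII.eventually (lt_mem_nhds (ENNReal.ofReal_lt_top (r := M / η)))] with z hz
  rw [← hI.enorm_delta, ← ofReal_norm] at hz
  have hlt : M / η < ‖hI.delta z‖ := (ENNReal.ofReal_lt_ofReal_iff'.1 hz).1
  rw [div_lt_iff₀' hη] at hlt
  exact (hM z).trans hlt.le

end Conditions

/-! ### The essential norm of the Volterra operator -/

section EssNorm

variable {X Y Z : Type*} [NormedAddCommGroup X] [NormedSpace ℂ X] [NormedAddCommGroup Y]
  [NormedSpace ℂ Y] [NormedAddCommGroup Z] [NormedSpace ℂ Z]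

theorem essNorm_le {T K : X →L[ℂ] Y} (hK : IsCompactOperator K) : essNorm T ≤ ‖T - K‖ₑ :=
  iInf₂_le K hK

theorem le_mul_essNorm {T : X →L[ℂ] Y} {a : ℝ≥0∞} {c : ℝ≥0}
    (h : ∀ K : X →L[ℂ] Y, IsCompactOperator K → a ≤ c * ‖T - K‖ₑ) : a ≤ c * essNorm T := by
  have : Nonempty {K : X →L[ℂ] Y // IsCompactOperator K} := ⟨0, isCompactOperator_zero⟩
  rw [essNorm, iInf_subtype', ENNReal.mul_iInf (by simp)]
  exact le_iInf fun K => h K K.2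

theorem essNorm_comp_le (J : Y →L[ℂ] Z) (T : X →L[ℂ] Y) :
    essNorm (J.comp T) ≤ ‖J‖₊ * essNorm T := by
  refine le_mul_essNorm fun K hK => (essNorm_le (K := J.comp K) (hK.clm_comp J)).trans ?_
  rw [← ContinuousLinearMap.comp_sub]
  exact J.opENorm_comp_le (T - K)

theorem exists_finite_net_of_isCompactOperator {K : X →L[ℂ] Y} (hK : IsCompactOperator K)
    {A : Set X} (hA : Bornology.IsBounded A) {ε : ℝ} (hε : 0 < ε) :
    ∃ t ⊆ A, t.Finite ∧ ∀ f ∈ A, ∃ h ∈ t, ‖K f - K h‖ < ε := by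
  have hKA : TotallyBounded (K '' A) :=
    (hK.isCompact_closure_image_of_bounded hA).totallyBounded.subset subset_closure
  obtain ⟨t, htA, htfin, hcover⟩ :=
    Set.exists_subset_image_finite_and.1 (Metric.finite_approx_of_totallyBounded hKA ε hε)
  refine ⟨t, htA, htfin, fun f hf => ?_⟩
  simpa [dist_eq_norm] using hcover ⟨f, hf, rfl⟩

theorem norm_apply_sub_le (T K : X →L[ℂ] Y) {C : ℝ≥0} {f h : X} (hf : ‖f‖ ≤ C)
    (hh : ‖h‖ ≤ C) : ‖T (f - h)‖ ≤ 2 * C * ‖T - K‖ + ‖K f - K h‖ := by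
  have hfh : ‖f - h‖ ≤ 2 * C := (norm_sub_le f h).trans (by linarith)
  have hsplit : T (f - h) = (T - K) (f - h) + (K f - K h) := by
    simp only [sub_apply, map_sub]
    abel
  rw [hsplit, mul_comm]
  exact norm_add_le_of_le ((T - K).le_opNorm_of_le hfh) le_rfl

theorem essNorm_le_mul_essNorm_equiv_comp (e : Y ≃L[ℂ] Z) (T : X →L[ℂ] Y) :
    essNorm T ≤ ‖(e.symm : Z →L[ℂ] Y)‖₊ * essNorm ((e : Y →L[ℂ] Z).comp T) := by
  have h := essNorm_comp_le (e.symm : Z →L[ℂ] Y) ((e : Y →L[ℂ] Z).comp T)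
  rwa [← ContinuousLinearMap.comp_assoc, e.coe_symm_comp_coe, ContinuousLinearMap.id_comp] at h

end EssNorm

theorem le_ofReal_of_forall_pos {a : ℝ≥0∞} {b c : ℝ}
    (h : ∀ ε > 0, a ≤ ENNReal.ofReal (b + ε * c)) : a ≤ ENNReal.ofReal b := by
  have hlim : Tendsto (fun ε : ℝ => ENNReal.ofReal (b + ε * c)) (𝓝[>] 0)
      (𝓝 (ENNReal.ofReal b)) := by
    have hcont : Continuous fun ε : ℝ => ENNReal.ofReal (b + ε * c) :=
      ENNReal.continuous_ofReal.comp (by fun_prop)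
    simpa using (hcont.tendsto 0).mono_left nhdsWithin_le_nhds
  exact ge_of_tendsto hlim (eventually_mem_nhdsWithin.mono h)

theorem Bloch.mul_norm_dd_le {v : Weight} (f : Bloch v) (z : 𝔻) :
    v z * ‖dd f.toHolD z‖ ≤ ‖f‖ := by
  rw [Bloch.norm_def]
  exact (le_ciSup f.bdd z).trans (le_add_of_nonneg_left (norm_nonneg _))

theorem Bloch.norm_le {v : Weight} (f : Bloch v) {a b : ℝ} (ha : ‖f.toHolD 0‖ ≤ a)
    (hb : ∀ z, v z * ‖dd f.toHolD z‖ ≤ b) : ‖f‖ ≤ a + b := by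
  have : Nonempty 𝔻 := ⟨0⟩
  rw [Bloch.norm_def]
  exact add_le_add ha (ciSup_le hb)

/-- The quantity `v(z) |(g ∘ φ)'(z)|`, with which the value `f(φ(z))` enters the `B_v^∞`-norm of
`T_g^φ f`. -/
def symbolWeight (v : Weight) (g : HolD) (φ : 𝔻 → 𝔻) (z : 𝔻) : ℝ :=
  v z * ‖dd (fun w => g (φ w)) z‖

theorem symbolWeight_nonneg (v : Weight) (g : HolD) (φ : 𝔻 → 𝔻) (z : 𝔻) :
    0 ≤ symbolWeight v g φ z :=
  mul_nonneg (v.pos z).le (norm_nonneg _)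

section Volterra

variable {X : Type*} [NormedAddCommGroup X] [NormedSpace ℂ X] {ι : X →ₗ[ℂ] HolD}

/-- The quantity `L = limsup_{|φ(z)| → 1} v(z) |(g ∘ φ)'(z)| ‖δ_{φ(z)}‖` which measures the
essential norm of the Volterra operator into `B_v^∞`. -/
def symbolLimsup (ι : X →ₗ[ℂ] HolD) (v : Weight) (g : HolD) (φ : 𝔻 → 𝔻) : ℝ≥0∞ :=
  limsupAt φ fun z => ENNReal.ofReal (symbolWeight v g φ z) * evalNorm ι (φ z)

theorem CondI.symbolLimsup_eq (hI : CondI ι) (v : Weight) (g : HolD) (φ : 𝔻 → 𝔻) :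
    symbolLimsup ι v g φ =
      limsupAt φ fun z => ENNReal.ofReal (symbolWeight v g φ z * ‖hI.delta (φ z)‖) := by
  simp only [symbolLimsup, ← hI.enorm_delta, ← ofReal_norm,
    ENNReal.ofReal_mul (symbolWeight_nonneg _ _ _ _)]

variable {v : Weight} {g : HolD} {φ : 𝔻 → 𝔻} {T : X →L[ℂ] Bloch v}

theorem symbolWeight_mul_norm_apply (hφ : IsHol fun z => (φ z : ℂ))
    (hT : ∀ f z, (T f).toHolD z = volterra g φ (ι f) z) (f : X) (z : 𝔻) :
    symbolWeight v g φ z * ‖ι f (φ z)‖ = v z * ‖dd (T f).toHolD z‖ := by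
  rw [dd_volterra hφ (hT f), norm_mul, symbolWeight]
  ring

theorem symbolWeight_mul_norm_apply_le (hφ : IsHol fun z => (φ z : ℂ))
    (hT : ∀ f z, (T f).toHolD z = volterra g φ (ι f) z) (f : X) (z : 𝔻) :
    symbolWeight v g φ z * ‖ι f (φ z)‖ ≤ ‖T f‖ :=
  (symbolWeight_mul_norm_apply hφ hT f z).trans_le ((T f).mul_norm_dd_le z)

theorem CondI.symbolWeight_mul_norm_delta_le (hI : CondI ι) (hφ : IsHol fun z => (φ z : ℂ))
    (hT : ∀ f z, (T f).toHolD z = volterra g φ (ι f) z) (z : 𝔻) :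
    symbolWeight v g φ z * ‖hI.delta (φ z)‖ ≤ ‖T‖ := by
  have hp := symbolWeight_nonneg v g φ z
  suffices ‖(symbolWeight v g φ z : ℂ) • hI.delta (φ z)‖ ≤ ‖T‖ by
    rwa [norm_smul, Complex.norm_of_nonneg hp] at this
  refine ContinuousLinearMap.opNorm_le_bound _ (norm_nonneg T) fun f => ?_
  rw [smul_apply, norm_smul, Complex.norm_of_nonneg hp, hI.delta_apply]
  exact (symbolWeight_mul_norm_apply_le hφ hT f z).trans (T.le_opNorm f)

theorem exists_norm_le_of_symbolWeight_mul_norm_delta_le (hconst : ContainsConstants ι)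
    (hI : CondI ι) (hφ : IsHol fun z => (φ z : ℂ))
    (hT : ∀ f z, (T f).toHolD z = volterra g φ (ι f) z) {s B : ℝ} (h0 : ‖(φ 0 : ℂ)‖ ≤ s)
    (hB : 0 ≤ B)
    (hs : ∀ z, s < ‖(φ z : ℂ)‖ → symbolWeight v g φ z * ‖hI.delta (φ z)‖ ≤ B) :
    ∃ D : ℝ, ∀ (f : X) (m : ℝ), (∀ w : 𝔻, ‖(w : ℂ)‖ ≤ s → ‖ι f w‖ ≤ m) →
      ‖T f‖ ≤ m * D + B * ‖f‖ := by
  obtain ⟨e, he⟩ := hconst 1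
  have hbdd : ∀ z, symbolWeight v g φ z ≤ ‖T e‖ := fun z => by
    simpa [he] using symbolWeight_mul_norm_apply_le hφ hT e z
  obtain ⟨D₀, hD₀⟩ := exists_norm_volterra_le g φ 0
  refine ⟨D₀ + ‖T e‖, fun f m hm => ?_⟩
  have hm0 : 0 ≤ m := (norm_nonneg _).trans (hm (φ 0) h0)
  have hvalue : ‖(T f).toHolD 0‖ ≤ D₀ * m := by
    rw [hT]
    exact hD₀ _ m fun w hw => hm w (hw.trans h0)
  have hderiv : ∀ z, v z * ‖dd (T f).toHolD z‖ ≤ ‖T e‖ * m + B * ‖f‖ := fun z => by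
    rw [← symbolWeight_mul_norm_apply hφ hT]
    have hp := symbolWeight_nonneg v g φ z
    rcases le_or_gt ‖(φ z : ℂ)‖ s with hz | hz
    · exact (mul_le_mul (hbdd z) (hm _ hz) (norm_nonneg _) (norm_nonneg _)).trans
        (le_add_of_nonneg_right (by positivity))
    · calc symbolWeight v g φ z * ‖ι f (φ z)‖
          ≤ symbolWeight v g φ z * (‖hI.delta (φ z)‖ * ‖f‖) := by
            gcongr
            exact (hI.delta (φ z)).le_opNorm f
        _ = symbolWeight v g φ z * ‖hI.delta (φ z)‖ * ‖f‖ := by ring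
        _ ≤ B * ‖f‖ := by
            gcongr
            exact hs z hz
        _ ≤ ‖T e‖ * m + B * ‖f‖ := le_add_of_nonneg_left (by positivity)
  linarith [(T f).norm_le hvalue hderiv]

theorem essNorm_le_of_symbolWeight_mul_norm_delta_le (hconst : ContainsConstants ι)
    (hI : CondI ι) {C : ℝ≥0} (hC : HasCompactDilations ι C) (hφ : IsHol fun z => (φ z : ℂ))
    (hT : ∀ f z, (T f).toHolD z = volterra g φ (ι f) z) {s B : ℝ} (hs : s < 1)
    (h0 : ‖(φ 0 : ℂ)‖ ≤ s) (hB : 0 ≤ B)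
    (hsB : ∀ z, s < ‖(φ z : ℂ)‖ → symbolWeight v g φ z * ‖hI.delta (φ z)‖ ≤ B) :
    essNorm T ≤ ENNReal.ofReal ((1 + C) * B) := by
  obtain ⟨D, hD⟩ :=
    exists_norm_le_of_symbolWeight_mul_norm_delta_le hconst hI hφ hT h0 hB hsB
  refine le_ofReal_of_forall_pos (c := D) fun η hη => ?_
  obtain ⟨r, hr, hr0, hr1⟩ := (((hI.eventually_norm_sub_ext_mul_le hs hη).filter_mono
    nhdsWithin_le_nhds).and (Ioo_mem_nhdsLT one_pos)).exists
  obtain ⟨S, hS, hScomp, hSC⟩ := hC r hr0 hr1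
  have hdist : ‖T - T.comp S‖ ≤ max 0 ((1 + C) * B + η * D) := by
    refine ContinuousLinearMap.opNorm_le_of_unit_norm (le_max_left _ _) fun f hf => ?_
    have hsmall : ∀ w : 𝔻, ‖(w : ℂ)‖ ≤ s → ‖ι (f - S f) w‖ ≤ η := fun w hw => by
      rw [map_sub_apply, hS]
      exact hr f hf.le w hw
    have hnorm : ‖f - S f‖ ≤ 1 + C := by
      have := S.le_of_opNorm_le_of_le hSC hf.le
      linarith [norm_sub_le f (S f)]
    have hTf : (T - T.comp S) f = T (f - S f) := by simp
    rw [hTf]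
    refine le_max_of_le_right ((hD _ η hsmall).trans ?_)
    linarith [mul_le_mul_of_nonneg_left hnorm hB]
  calc essNorm T ≤ ‖T - T.comp S‖ₑ := essNorm_le (hScomp.clm_comp T)
    _ = ENNReal.ofReal ‖T - T.comp S‖ := (ofReal_norm _).symm
    _ ≤ ENNReal.ofReal ((1 + C) * B + η * D) := by
        simpa using ENNReal.ofReal_le_ofReal hdist

theorem essNorm_le_mul_symbolLimsup (hconst : ContainsConstants ι) (hI : CondI ι) {C : ℝ≥0}
    (hC : HasCompactDilations ι C) (hφ : IsHol fun z => (φ z : ℂ))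
    (hT : ∀ f z, (T f).toHolD z = volterra g φ (ι f) z) :
    essNorm T ≤ (1 + C : ℝ≥0) * symbolLimsup ι v g φ := by
  have hne : ((1 + C : ℝ≥0) : ℝ≥0∞) ≠ 0 := by simp
  rw [← ENNReal.div_le_iff' hne ENNReal.coe_ne_top]
  refine le_of_forall_gt_imp_ge_of_dense fun b hb => ?_
  rcases eq_or_ne b ∞ with rfl | hb'
  · exact le_top
  lift b to ℝ≥0 using hb'
  rw [hI.symbolLimsup_eq] at hb
  obtain ⟨s, hs, hsb⟩ := exists_lt_one_of_eventually_toBoundary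
    (eventually_comap.1 (eventually_lt_of_limsup_lt hb))
  rw [ENNReal.div_le_iff' hne ENNReal.coe_ne_top]
  refine (essNorm_le_of_symbolWeight_mul_norm_delta_le hconst hI hC hφ hT
    (max_lt hs (φ 0).norm_lt_one) (le_max_right _ _) b.coe_nonneg fun z hz => ?_).trans_eq ?_
  · have := (hsb (φ z) ((le_max_left _ _).trans_lt hz) z rfl).le
    rw [← ENNReal.ofReal_coe_nnreal] at this
    exact (ENNReal.ofReal_le_ofReal_iff b.coe_nonneg).1 this
  · exact_mod_cast ENNReal.ofReal_coe_nnreal (p := (1 + C) * b)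

theorem symbolLimsup_le_of_isCompactOperator (hI : CondI ι) (hII : CondII ι) {C : ℝ≥0}
    (hC : HasCompactDilations ι C) (hφ : IsHol fun z => (φ z : ℂ))
    (hT : ∀ f z, (T f).toHolD z = volterra g φ (ι f) z) {K : X →L[ℂ] Bloch v}
    (hK : IsCompactOperator K) :
    symbolLimsup ι v g φ ≤ ENNReal.ofReal (2 * C * ‖T - K‖) := by
  refine le_ofReal_of_forall_pos (c := 1 + ‖T‖) fun ε hε => ?_
  have hbdd : Bornology.IsBounded (boundedBall ι C) :=
    (Metric.isBounded_closedBall (x := (0 : X)) (r := C)).subset fun h hh =>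
      mem_closedBall_zero_iff.2 hh.1
  obtain ⟨t, htA, htfin, hnet⟩ := exists_finite_net_of_isCompactOperator hK hbdd hε
  have hsmall : ∀ᶠ z in comap φ toBoundary, ∀ h ∈ t, ‖ι h (φ z)‖ ≤ ε * ‖hI.delta (φ z)‖ :=
    ((htfin.eventually_all).2 fun h hh =>
      hII.eventually_norm_apply_le hI (htA hh).2 hε).comap φ
  rw [hI.symbolLimsup_eq]
  refine limsup_le_of_le (by isBoundedDefault) (hsmall.mono fun z hz => ?_)
  refine ENNReal.ofReal_le_ofReal ?_
  have hp := symbolWeight_nonneg v g φ z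
  refine hC.mul_norm_delta_le hI hp (by positivity) fun f hf => ?_
  obtain ⟨h, hht, hKfh⟩ := hnet f hf
  have hsplit : ‖ι f (φ z)‖ ≤ ‖ι (f - h) (φ z)‖ + ‖ι h (φ z)‖ := by
    rw [map_sub_apply]
    exact norm_le_norm_sub_add _ _
  have hsub : symbolWeight v g φ z * ‖ι (f - h) (φ z)‖ ≤ 2 * C * ‖T - K‖ + ε :=
    (symbolWeight_mul_norm_apply_le hφ hT _ z).trans
      ((norm_apply_sub_le T K hf.1 (htA hht).1).trans (by gcongr))
  calc symbolWeight v g φ z * ‖ι f (φ z)‖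
      ≤ symbolWeight v g φ z * (‖ι (f - h) (φ z)‖ + ε * ‖hI.delta (φ z)‖) := by
        gcongr
        exact hsplit.trans (by gcongr; exact hz h hht)
    _ = symbolWeight v g φ z * ‖ι (f - h) (φ z)‖ +
          ε * (symbolWeight v g φ z * ‖hI.delta (φ z)‖) := by ring
    _ ≤ 2 * C * ‖T - K‖ + ε + ε * ‖T‖ := by
        gcongr
        exact hI.symbolWeight_mul_norm_delta_le hφ hT z
    _ = 2 * C * ‖T - K‖ + ε * (1 + ‖T‖) := by ring

theorem exists_essNorm_bloch_equiv (hι : Function.Injective ι) (hconst : ContainsConstants ι)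
    (hI : CondI ι) (hII : CondII ι) (hIII : CondIII ι) (hIV : CondIV ι) :
    ∃ c : ℝ≥0, 0 < c ∧ ∀ (v : Weight) (g : HolD) (φ : 𝔻 → 𝔻), IsHol (fun z => (φ z : ℂ)) →
      ∀ T : X →L[ℂ] Bloch v, (∀ f z, (T f).toHolD z = volterra g φ (ι f) z) →
        essNorm T ≤ c * symbolLimsup ι v g φ ∧ symbolLimsup ι v g φ ≤ c * essNorm T := by
  obtain ⟨C, hC⟩ := exists_hasCompactDilations hι hIII hIV
  refine ⟨1 + 2 * C, by positivity, fun v g φ hφ T hT => ⟨?_, le_mul_essNorm fun K hK => ?_⟩⟩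
  · refine (essNorm_le_mul_symbolLimsup hconst hI hC hφ hT).trans ?_
    gcongr
    exact le_mul_of_one_le_left C.2 one_le_two
  · calc symbolLimsup ι v g φ ≤ ENNReal.ofReal (2 * C * ‖T - K‖) :=
          symbolLimsup_le_of_isCompactOperator hI hII hC hφ hT hK
      _ = (2 * C : ℝ≥0) * ‖T - K‖ₑ := by
          exact_mod_cast ENNReal.ofReal_coe_nnreal (p := 2 * C * ‖T - K‖₊)
      _ ≤ (1 + 2 * C : ℝ≥0) * ‖T - K‖ₑ := by
          gcongr
          exact le_add_of_nonneg_left zero_le_one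

end Volterra

/-! ### Normal weights -/

theorem norm_dyadic (n : ℕ) : ‖(dyadic n : ℂ)‖ = 1 - (1 / 2) ^ n := by
  have hpow : ((1 : ℝ) / 2) ^ n ≤ 1 := pow_le_one₀ (by norm_num) (by norm_num)
  rw [dyadic, UnitDisc.coe_mk, Complex.norm_of_nonneg (sub_nonneg.2 hpow)]

theorem norm_dyadic_succ (n : ℕ) :
    ‖(dyadic (n + 1) : ℂ)‖ = ‖(dyadic n : ℂ)‖ + (1 / 2) ^ (n + 1) := by
  rw [norm_dyadic, norm_dyadic, pow_succ]
  ring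

theorem monotone_norm_dyadic : Monotone fun n => ‖(dyadic n : ℂ)‖ :=
  monotone_nat_of_le_succ fun n => by
    rw [norm_dyadic_succ]
    exact le_add_of_nonneg_right (by positivity)

theorem exists_dyadic_le_le (z : 𝔻) :
    ∃ n, ‖(dyadic n : ℂ)‖ ≤ ‖(z : ℂ)‖ ∧ ‖(z : ℂ)‖ ≤ ‖(dyadic (n + 1) : ℂ)‖ := by
  obtain ⟨n, hn, hn'⟩ := exists_nat_pow_near_of_lt_one (sub_pos.2 z.norm_lt_one)
    (sub_le_self 1 (norm_nonneg _)) one_half_pos one_half_lt_one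
  refine ⟨n, ?_, ?_⟩ <;> rw [norm_dyadic] <;> linarith

theorem exists_sum_range_le_mul {a : ℕ → ℝ} (hpos : ∀ n, 0 < a n) (hmono : Monotone a) {q : ℝ}
    (hq : q < 1) {k N : ℕ} (h : ∀ n, N ≤ n → a n ≤ q * a (n + k)) :
    ∃ C : ℝ, 0 ≤ C ∧ ∀ n, ∑ j ∈ Finset.range (n + 1), a j ≤ C * a n := by
  have hk : 0 < k := by
    refine Nat.pos_of_ne_zero ?_
    rintro rfl
    exact absurd (h N le_rfl) (not_le.2 (mul_lt_of_lt_one_left (hpos N) hq))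
  obtain ⟨C, hCinit, hCstep⟩ : ∃ C : ℝ, (N + k : ℝ) ≤ C ∧ k ≤ C * (1 - q) :=
    ⟨max (N + k) (k / (1 - q)), le_max_left _ _,
      (div_le_iff₀ (sub_pos.2 hq)).1 (le_max_right _ _)⟩
  have hC : 0 ≤ C := le_trans (by positivity) hCinit
  refine ⟨C, hC, fun n => ?_⟩
  induction n using Nat.strong_induction_on with
  | _ n ih =>
    rcases lt_or_ge n (N + k) with hn | hn
    · calc ∑ j ∈ Finset.range (n + 1), a j ≤ (n + 1 : ℕ) * a n := by
            simpa using Finset.sum_le_card_nsmul (Finset.range (n + 1)) a (a n) fun j hj =>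
              hmono (Finset.mem_range_succ_iff.1 hj)
        _ ≤ C * a n :=
            mul_le_mul_of_nonneg_right (le_trans (mod_cast hn) hCinit) (hpos n).le
    · obtain ⟨m, rfl⟩ : ∃ m, n = m + k := ⟨n - k, by omega⟩
      have hlast : ∑ j ∈ Finset.range k, a (m + 1 + j) ≤ k * a (m + k) := by
        simpa using Finset.sum_le_card_nsmul (Finset.range k) (fun j => a (m + 1 + j))
          (a (m + k)) fun j hj => hmono (by have := Finset.mem_range.1 hj; omega)
      calc ∑ j ∈ Finset.range (m + k + 1), a j
          = ∑ j ∈ Finset.range (m + 1), a j + ∑ j ∈ Finset.range k, a (m + 1 + j) := by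
            rw [add_right_comm, Finset.sum_range_add]
        _ ≤ C * (q * a (m + k)) + C * (1 - q) * a (m + k) :=
            add_le_add
              ((ih m (by omega)).trans (mul_le_mul_of_nonneg_left (h m (by omega)) hC))
              (hlast.trans (mul_le_mul_of_nonneg_right hCstep (hpos _).le))
        _ = C * a (m + k) := by ring

/-- The weight `(1 - |z|) v(z)`, for which `B^∞ = H_v^∞` if `v` is normal. -/
def Weight.distMul (v : Weight) : Weight where
  toFun z := (1 - ‖(z : ℂ)‖) * v z
  continuous_toFun :=
    (continuous_const.sub UnitDisc.continuous_coe.norm).mul v.continuous_toFun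
  pos z := mul_pos (sub_pos.2 z.norm_lt_one) (v.pos z)
  tendsto_zero :=
    squeeze_zero (fun z => mul_nonneg (sub_nonneg.2 z.norm_lt_one.le) (v.pos z).le)
      (fun z => mul_le_of_le_one_left (v.pos z).le (sub_le_self 1 (norm_nonneg _)))
      v.tendsto_zero

theorem Weight.distMul_apply (v : Weight) (z : 𝔻) : v.distMul z = (1 - ‖(z : ℂ)‖) * v z := rfl

namespace Weight.IsNormal

variable {v : Weight}

theorem exists_le_mul_dyadic_succ (hv : v.IsNormal) :
    ∃ E : ℝ, 0 ≤ E ∧ ∀ n, v (dyadic n) ≤ E * v (dyadic (n + 1)) := by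
  refine ⟨(⨆ n : ℕ, ENNReal.ofReal (v (dyadic n) / v (dyadic (n + 1)))).toReal,
    ENNReal.toReal_nonneg, fun n => ?_⟩
  rw [← div_le_iff₀ (v.pos _)]
  exact (ENNReal.ofReal_le_iff_le_toReal hv.sup_lt_top.ne).1
    (le_iSup (fun n : ℕ => ENNReal.ofReal (v (dyadic n) / v (dyadic (n + 1)))) n)

theorem exists_le_mul_of_norm_le (hv : v.IsNormal) :
    ∃ D : ℝ, 0 ≤ D ∧ ∀ z w : 𝔻, ‖(w : ℂ)‖ ≤ (1 + ‖(z : ℂ)‖) / 2 → v z ≤ D * v w := by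
  obtain ⟨E, hE, hvE⟩ := hv.exists_le_mul_dyadic_succ
  refine ⟨E * E, by positivity, fun z w hw => ?_⟩
  obtain ⟨n, hn, hn'⟩ := exists_dyadic_le_le z
  have hwn : ‖(w : ℂ)‖ ≤ ‖(dyadic (n + 2) : ℂ)‖ := by
    rw [norm_dyadic] at hn' ⊢
    rw [pow_succ _ (n + 1)]
    linarith
  calc v z ≤ v (dyadic n) := hv.antitone _ _ hn
    _ ≤ E * (E * v (dyadic (n + 2))) :=
        (hvE n).trans (mul_le_mul_of_nonneg_left (hvE (n + 1)) hE)
    _ ≤ E * E * v w := by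
        rw [← mul_assoc]
        exact mul_le_mul_of_nonneg_left (hv.antitone _ _ hwn) (by positivity)

theorem exists_dyadic_add_le_mul (hv : v.IsNormal) :
    ∃ (q : ℝ) (k N : ℕ), q < 1 ∧ ∀ n, N ≤ n → v (dyadic (n + k)) ≤ q * v (dyadic n) := by
  obtain ⟨k, hk⟩ := iInf_lt_iff.1 hv.inf_limsup_lt_one
  obtain ⟨q, hq0, hlim, hq1⟩ := ENNReal.lt_iff_exists_real_btwn.1 hk
  obtain ⟨N, hN⟩ := eventually_atTop.1 (eventually_lt_of_limsup_lt hlim)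
  refine ⟨q, k, N, ENNReal.ofReal_lt_one.1 hq1, fun n hn => ?_⟩
  rw [← div_le_iff₀ (v.pos _)]
  exact (ENNReal.ofReal_le_ofReal_iff hq0).1 (hN n hn).le

theorem exists_sum_inv_dyadic_le (hv : v.IsNormal) : ∃ C : ℝ, 0 ≤ C ∧
    ∀ n, ∑ j ∈ Finset.range (n + 1), (v (dyadic j))⁻¹ ≤ C * (v (dyadic n))⁻¹ := by
  obtain ⟨q, k, N, hq, h⟩ := hv.exists_dyadic_add_le_mul
  refine exists_sum_range_le_mul (fun n => inv_pos.2 (v.pos _)) (fun m n hmn => ?_) hq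
    (k := k) (N := N) fun n hn => ?_
  · exact inv_anti₀ (v.pos _) (hv.antitone _ _ (monotone_norm_dyadic hmn))
  · rw [← div_eq_mul_inv, inv_eq_one_div, div_le_div_iff₀ (v.pos _) (v.pos _), one_mul]
    exact h n hn

theorem exists_distMul_mul_norm_dd_le (hv : v.IsNormal) : ∃ C : ℝ, ∀ (f : HolD) (A : ℝ),
    (∀ z, v z * ‖f z‖ ≤ A) → ∀ z, v.distMul z * ‖dd f z‖ ≤ C * A := by
  obtain ⟨D, hD, hvD⟩ := hv.exists_le_mul_of_norm_le
  refine ⟨2 * D, fun f A hA z => ?_⟩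
  have hz := z.norm_lt_one
  have hvz := v.pos z
  have hf : ∀ w : 𝔻, ‖(w : ℂ)‖ ≤ ‖(z : ℂ)‖ + (1 - ‖(z : ℂ)‖) / 2 → ‖f w‖ ≤ D * A / v z :=
    fun w hw => by
      rw [le_div_iff₀' hvz]
      calc v z * ‖f w‖ ≤ D * v w * ‖f w‖ := by
            gcongr
            exact hvD z w (by linarith)
        _ = D * (v w * ‖f w‖) := mul_assoc _ _ _
        _ ≤ D * A := mul_le_mul_of_nonneg_left (hA w) hD
  have hcauchy := f.norm_dd_le (ρ := (1 - ‖(z : ℂ)‖) / 2) (by linarith) (by linarith) hf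
  rw [le_div_iff₀ (by linarith), le_div_iff₀ hvz] at hcauchy
  rw [distMul_apply]
  linarith

theorem exists_norm_sub_le_of_norm_le_dyadic_succ (hv : v.IsNormal) {f : HolD} {A : ℝ}
    (hA : ∀ z, v.distMul z * ‖dd f z‖ ≤ A) {n : ℕ} {z : 𝔻}
    (hz : ‖(z : ℂ)‖ ≤ ‖(dyadic (n + 1) : ℂ)‖) :
    ∃ w : 𝔻, ‖(w : ℂ)‖ ≤ ‖(dyadic n : ℂ)‖ ∧ ‖f z - f w‖ ≤ A * (v (dyadic (n + 1)))⁻¹ := by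
  have hvn := v.pos (dyadic (n + 1))
  obtain ⟨w, hzw, hw⟩ := exists_dist_le_le (x := (z : ℂ)) (z := 0) (ε := ‖(dyadic n : ℂ)‖)
    (δ := (1 / 2) ^ (n + 1)) (by positivity) (norm_nonneg _)
    (by rwa [dist_zero_right, ← norm_dyadic_succ])
  rw [dist_zero_right] at hw
  rw [dist_eq_norm] at hzw
  have hderiv : ∀ u : 𝔻, ‖(u : ℂ)‖ ≤ ‖(dyadic (n + 1) : ℂ)‖ →
      ‖dd f u‖ ≤ A / ((1 / 2) ^ (n + 1) * v (dyadic (n + 1))) := fun u hu => by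
    have hdist : (1 / 2) ^ (n + 1) ≤ 1 - ‖(u : ℂ)‖ := by
      rw [norm_dyadic] at hu
      linarith
    rw [le_div_iff₀' (by positivity)]
    refine le_trans ?_ (hA u)
    rw [distMul_apply]
    have hvu := hv.antitone _ _ hu
    have hu1 := sub_nonneg.2 u.norm_lt_one.le
    gcongr
  have hA0 : 0 ≤ A := le_trans (mul_nonneg (v.distMul.pos 0).le (norm_nonneg _)) (hA 0)
  refine ⟨UnitDisc.mk w (hw.trans_lt (dyadic n).norm_lt_one), hw, ?_⟩
  calc ‖f z - f (UnitDisc.mk w _)‖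
      ≤ A / ((1 / 2) ^ (n + 1) * v (dyadic (n + 1))) * ‖(z : ℂ) - w‖ :=
        f.norm_sub_le (dyadic (n + 1)).norm_lt_one hderiv hz
          (hw.trans (monotone_norm_dyadic n.le_succ))
    _ ≤ A / ((1 / 2) ^ (n + 1) * v (dyadic (n + 1))) * (1 / 2) ^ (n + 1) := by gcongr
    _ = A * (v (dyadic (n + 1)))⁻¹ := by field_simp

theorem norm_apply_le_sum_dyadic (hv : v.IsNormal) {f : HolD} {A : ℝ}
    (hA : ∀ z, v.distMul z * ‖dd f z‖ ≤ A) (n : ℕ) {z : 𝔻}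
    (hz : ‖(z : ℂ)‖ ≤ ‖(dyadic n : ℂ)‖) :
    ‖f z‖ ≤ ‖f 0‖ + A * ∑ j ∈ Finset.range n, (v (dyadic (j + 1)))⁻¹ := by
  induction n generalizing z with
  | zero =>
    rw [norm_dyadic, pow_zero, sub_self, norm_le_zero_iff] at hz
    obtain rfl : z = 0 := UnitDisc.coe_injective hz
    simp
  | succ n ih =>
    obtain ⟨w, hw, hzw⟩ := hv.exists_norm_sub_le_of_norm_le_dyadic_succ hA hz
    rw [Finset.sum_range_succ, mul_add]
    linarith [ih hw, norm_le_norm_sub_add (f z) (f w)]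

theorem exists_mul_norm_apply_le (hv : v.IsNormal) : ∃ C : ℝ, ∀ (f : HolD) (A : ℝ),
    (∀ z, v.distMul z * ‖dd f z‖ ≤ A) → ∀ z, v z * ‖f z‖ ≤ C * (‖f 0‖ + A) := by
  obtain ⟨D, hD, hvD⟩ := hv.exists_le_mul_of_norm_le
  obtain ⟨C, hC, hvC⟩ := hv.exists_sum_inv_dyadic_le
  have hv0 := v.pos 0
  refine ⟨v 0 + D * C, fun f A hA z => ?_⟩
  have hA0 : 0 ≤ A := le_trans (mul_nonneg (v.distMul.pos 0).le (norm_nonneg _)) (hA 0)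
  have hvz := v.pos z
  obtain ⟨n, hn, hn'⟩ := exists_dyadic_le_le z
  have hvn := v.pos (dyadic (n + 1))
  have hvz0 : v z ≤ v 0 := hv.antitone 0 z (by simp)
  have hvzn : v z ≤ D * v (dyadic (n + 1)) := hvD z _ (by
    rw [norm_dyadic] at hn ⊢
    rw [pow_succ]
    linarith)
  have hsum : ∑ j ∈ Finset.range (n + 1), (v (dyadic (j + 1)))⁻¹ ≤
      C * (v (dyadic (n + 1)))⁻¹ := by
    have h := hvC (n + 1)
    rw [Finset.sum_range_succ'] at h
    exact (le_add_of_nonneg_right (inv_pos.2 (v.pos _)).le).trans h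
  calc v z * ‖f z‖ ≤ v z * (‖f 0‖ + A * (C * (v (dyadic (n + 1)))⁻¹)) := by
        gcongr
        exact (hv.norm_apply_le_sum_dyadic hA (n + 1) hn').trans (by gcongr)
    _ = v z * ‖f 0‖ + v z * (A * (C * (v (dyadic (n + 1)))⁻¹)) := mul_add _ _ _
    _ ≤ v 0 * ‖f 0‖ + D * v (dyadic (n + 1)) * (A * (C * (v (dyadic (n + 1)))⁻¹)) := by gcongr
    _ = v 0 * ‖f 0‖ + D * C * A := by field_simp
    _ ≤ (v 0 + D * C) * (‖f 0‖ + A) := by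
        have : 0 ≤ v 0 * A + D * C * ‖f 0‖ := by positivity
        linarith

end Weight.IsNormal

theorem HInf.mul_norm_apply_le {v : Weight} (f : HInf v) (z : 𝔻) : v z * ‖f.toHolD z‖ ≤ ‖f‖ :=
  le_ciSup f.bdd z

theorem HInf.norm_le {v : Weight} (f : HInf v) {a : ℝ} (h : ∀ z, v z * ‖f.toHolD z‖ ≤ a) :
    ‖f‖ ≤ a := by
  have : Nonempty 𝔻 := ⟨0⟩
  exact ciSup_le h

theorem Weight.IsNormal.hInfSub_eq {v : Weight} (hv : v.IsNormal) :
    hInfSub v = blochSub v.distMul := by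
  obtain ⟨C, hC⟩ := hv.exists_distMul_mul_norm_dd_le
  obtain ⟨C', hC'⟩ := hv.exists_mul_norm_apply_le
  ext f
  constructor <;> rintro ⟨A, hA⟩ <;> rw [mem_upperBounds, Set.forall_mem_range] at hA
  · exact ⟨C * A, Set.forall_mem_range.2 (hC f A hA)⟩
  · exact ⟨C' * (‖f 0‖ + A), Set.forall_mem_range.2 (hC' f A hA)⟩

theorem Weight.IsNormal.exists_equiv_bloch {v : Weight} (hv : v.IsNormal) :
    ∃ e : HInf v ≃L[ℂ] Bloch v.distMul, ∀ f, (e f).toHolD = f.toHolD := by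
  obtain ⟨C, hC⟩ := hv.exists_distMul_mul_norm_dd_le
  obtain ⟨C', hC'⟩ := hv.exists_mul_norm_apply_le
  let e : HInf v ≃ₗ[ℂ] Bloch v.distMul := LinearEquiv.ofEq _ _ hv.hInfSub_eq
  have hto : ∀ f, ‖e f‖ ≤ ((v 0)⁻¹ + C) * ‖f‖ := fun f => by
    rw [add_mul]
    refine (e f).norm_le ?_ (hC f.toHolD ‖f‖ f.mul_norm_apply_le)
    rw [← div_eq_inv_mul, le_div_iff₀' (v.pos 0)]
    exact f.mul_norm_apply_le 0
  have hinv : ∀ f, ‖e.symm f‖ ≤ C' * ‖f‖ := fun f => by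
    rw [Bloch.norm_def]
    exact (e.symm f).norm_le (hC' f.toHolD _ (le_ciSup f.bdd))
  exact ⟨e.toContinuousLinearEquivOfBounds _ _ hto hinv, fun f => rfl⟩

theorem Weight.IsNormal.exists_essNorm_hInf_equiv {X : Type*} [NormedAddCommGroup X]
    [NormedSpace ℂ X] {ι : X →ₗ[ℂ] HolD} {v : Weight} (hv : v.IsNormal)
    (hι : Function.Injective ι) (hconst : ContainsConstants ι)
    (hI : CondI ι) (hII : CondII ι) (hIII : CondIII ι) (hIV : CondIV ι) :
    ∃ c : ℝ≥0, 0 < c ∧ ∀ (g : HolD) (φ : 𝔻 → 𝔻), IsHol (fun z => (φ z : ℂ)) →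
      ∀ T : X →L[ℂ] HInf v, (∀ f z, (T f).toHolD z = volterra g φ (ι f) z) →
        essNorm T ≤ c * symbolLimsup ι v.distMul g φ ∧
          symbolLimsup ι v.distMul g φ ≤ c * essNorm T := by
  obtain ⟨c, hc, hbloch⟩ := exists_essNorm_bloch_equiv hι hconst hI hII hIII hIV
  obtain ⟨e, he⟩ := hv.exists_equiv_bloch
  let J : HInf v →L[ℂ] Bloch v.distMul := e.toContinuousLinearMap
  let J' : Bloch v.distMul →L[ℂ] HInf v := e.symm.toContinuousLinearMap
  refine ⟨(‖J‖₊ + ‖J'‖₊ + 1) * c, by positivity, fun g φ hφ T hT => ?_⟩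
  obtain ⟨hle, hge⟩ := hbloch v.distMul g φ hφ (J.comp T) fun f z => by
    rw [← hT]
    exact congrArg (fun F : HolD => F z) (he (T f))
  constructor
  · calc essNorm T ≤ ‖J'‖₊ * essNorm (J.comp T) := essNorm_le_mul_essNorm_equiv_comp e T
      _ ≤ ‖J'‖₊ * (c * symbolLimsup ι v.distMul g φ) := by gcongr
      _ ≤ ((‖J‖₊ + ‖J'‖₊ + 1) * c : ℝ≥0) * symbolLimsup ι v.distMul g φ := by
        rw [← mul_assoc, ← ENNReal.coe_mul]
        gcongr
        exact le_add_right (le_add_of_nonneg_left zero_le)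
  · calc symbolLimsup ι v.distMul g φ ≤ c * essNorm (J.comp T) := hge
      _ ≤ c * (‖J‖₊ * essNorm T) := by gcongr; exact essNorm_comp_le J T
      _ ≤ ((‖J‖₊ + ‖J'‖₊ + 1) * c : ℝ≥0) * essNorm T := by
        rw [← mul_assoc, ← ENNReal.coe_mul, mul_comm c]
        gcongr
        exact le_add_right (le_add_of_nonneg_right zero_le)

end VolterraEss

end

open VolterraEss in
theorem theorem3p7_general {X : Type*} [NormedAddCommGroup X] [NormedSpace ℂ X]
    (ι : X →ₗ[ℂ] HolD) (hι : Function.Injective ι) (hconst : ContainsConstants ι)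
    (hI : CondI ι) (hII : CondII ι) (hIII : CondIII ι) (hIV : CondIV ι) :
    (∀ v : Weight, v.IsNormal → ∃ c : ℝ≥0, 0 < c ∧
      ∀ (g : HolD) (φ : 𝔻 → 𝔻), IsHol (fun z => (φ z : ℂ)) →
      ∀ T : X →L[ℂ] HInf v, (∀ f z, (T f).toHolD z = volterra g φ (ι f) z) →
        essNorm T ≤ c * symbolLimsup ι v.distMul g φ ∧
          symbolLimsup ι v.distMul g φ ≤ c * essNorm T) ∧
    (∃ c : ℝ≥0, 0 < c ∧ ∀ (v : Weight) (g : HolD) (φ : 𝔻 → 𝔻),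
      IsHol (fun z => (φ z : ℂ)) →
      ∀ T : X →L[ℂ] Bloch v, (∀ f z, (T f).toHolD z = volterra g φ (ι f) z) →
        essNorm T ≤ c * symbolLimsup ι v g φ ∧ symbolLimsup ι v g φ ≤ c * essNorm T) :=
  ⟨fun _ hv => hv.exists_essNorm_hInf_equiv hι hconst hI hII hIII hIV,
    exists_essNorm_bloch_equiv hι hconst hI hII hIII hIV⟩

open VolterraEss in
theorem theorem3p7 {X : Type*} [NormedAddCommGroup X] [NormedSpace ℂ X] [CompleteSpace X]
    (ι : X →ₗ[ℂ] HolD) (hι : Function.Injective ι) (hconst : ContainsConstants ι)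
    (hI : CondI ι) (hII : CondII ι) (hIII : CondIII ι) (hIV : CondIV ι) (hV : CondV ι) :
    (∀ v : Weight, v.IsNormal → ∃ c : ℝ≥0, 0 < c ∧
      ∀ (g : HolD) (φ : 𝔻 → 𝔻), IsHol (fun z => (φ z : ℂ)) →
      ∀ T : X →L[ℂ] HInf v, (∀ f z, (T f).toHolD z = volterra g φ (ι f) z) →
        essNorm T ≤ c * limsupAt φ (fun z =>
          ENNReal.ofReal ((1 - ‖(z : ℂ)‖) * v z * ‖dd (fun w => g (φ w)) z‖) *
            evalNorm ι (φ z)) ∧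
        limsupAt φ (fun z =>
          ENNReal.ofReal ((1 - ‖(z : ℂ)‖) * v z * ‖dd (fun w => g (φ w)) z‖) *
            evalNorm ι (φ z)) ≤ c * essNorm T) ∧
    (∃ c : ℝ≥0, 0 < c ∧ ∀ (v : Weight) (g : HolD) (φ : 𝔻 → 𝔻),
      IsHol (fun z => (φ z : ℂ)) →
      ∀ T : X →L[ℂ] Bloch v, (∀ f z, (T f).toHolD z = volterra g φ (ι f) z) →
        essNorm T ≤ c * limsupAt φ (fun z =>
          ENNReal.ofReal (v z * ‖dd (fun w => g (φ w)) z‖) * evalNorm ι (φ z)) ∧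
        limsupAt φ (fun z =>
          ENNReal.ofReal (v z * ‖dd (fun w => g (φ w)) z‖) * evalNorm ι (φ z)) ≤
            c * essNorm T) :=
  theorem3p7_general ι hι hconst hI hII hIII hIV
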